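/- \textbf{Theorem (consistency of the NN-GLS estimator).} For each $n$, let $X_1,\dots,X_n$ be fixed covariate vectors in a compact set $K\subset\mathbb{R}^d$ ($K$ not depending on $n$), and let $Y_i=f_0(X_i)+\varepsilon_i$, $i=1,\dots,n$, where $f_0$ is continuous and $(\varepsilon_1,\dots,\varepsilon_n)$ is a mean-zero Gaussian process; the $X_i$ and the $\varepsilon_i$ may change with $n$ (a single infinite sequence is a special case). Assume the following. (1) All eigenvalues of the covariance matrix $\Sigma=\Sigma_n=\mathrm{Cov}(Y_1,\dots,Y_n)$ lie in $[\Psi_{low},\Psi_{high}]$, with $0<\Psi_{low}\le\Psi_{high}<\infty$ independent of $n$. (2) Let $\sigma:\mathbb{R}\to\mathbb{R}$ be a sigmoid-type activation function: nonconstant, nondecreasing, Lipschitz with constant $L_{lip}$, and with values in $[-r_b,r_b]$ (for example the logistic sigmoid, with $r_b=1$ and $L_{lip}=1/4$). The function class is $$\mathcal{F}_n=\Big\{x\mapsto \alpha_0+\sum_{j=1}^{r_n}\alpha_j\,\sigma(\gamma_j^\top x+\gamma_{0,j}) \;:\; \alpha_j,\gamma_{0,j}\in\mathbb{R},\ \gamma_j=(\gamma_{1,j},\dots,\gamma_{d,j})\in\mathbb{R}^d,\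 \sum_{j=0}^{r_n}|\alpha_j|\le V_n,\ \max_{1\le j\le r_n}\sum_{i=0}^{d}|\gamma_{i,j}|\le M_n\Big\},$$ where $V_n>1/L_{lip}$, $M_n>0$, the quantities $r_n\in\mathbb{N}$, $V_n$, $M_n$ all tend to $\infty$, and $r_nV_n^2\log(V_nr_n)=o(n)$. (3) The working precision matrix $Q=Q_n$ is a deterministic symmetric $n\times n$ matrix, and all eigenvalues of $E=\Sigma^{\top/2}Q\,\Sigma^{1/2}$ lie in $(\Lambda_{low},\Lambda_{high})$, with constants $0<\Lambda_{low}\le 1\le\Lambda_{high}<\infty$ independent of $n$. Here $\Sigma^{1/2}$ is any square matrix $R$ with $RR^\top=\Sigma$, and $\Sigma^{\top/2}=R^\top$. Let $\hat f_n$ be any minimizer over $f\in\mathcal{F}_n$ of the GLS loss $$\mathcal{L}_n(f)=\frac1n\,(Y-f(X))^\top Q\,(Y-f(X)),\qquad Y=(Y_1,\dots,Y_n)^\top,\quad f(X)=(f(X_1),\dots,f(X_n))^\top.$$ Then, with $\|f\|_n^2=\frac1n\sum_{i=1}^n f(X_i)^2$, one has $\|\hat f_n-f_0\|_n\to0$ in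 probability as $n\to\infty$. -/

import Mathlib

open MeasureTheory ProbabilityTheory Filter Topology Asymptotics
open scoped Matrix NNReal

namespace NNGLS

/-- A sigmoid-type activation function with constants `rb` and `L`: a nonconstant nondecreasing
function on the line that is Lipschitz with constant `L` and takes its values in `[-rb, rb]`.
The logistic sigmoid is one, with `rb = 1` and `L = 1 / 4`. -/
structure IsActivation (σ : ℝ → ℝ) (rb : ℝ) (L : ℝ≥0) : Prop where
  monotone : Monotone σ
  nonconstant : ∃ s t, σ s ≠ σ t
  lipschitz : LipschitzWith L σ
  bounded : ∀ t, σ t ∈ Set.Icc (-rb) rb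

/-- The sieve of one-hidden-layer networks `x ↦ α₀ + ∑ⱼ αⱼ σ (γⱼᵀ x + γ₀ⱼ)` with `r` hidden units,
`∑ⱼ |αⱼ| ≤ V` (the sum starting with `α₀`), and, for every unit `j`, `∑ᵢ |γᵢⱼ| ≤ M` (the sum
starting with `γ₀ⱼ`). -/
def sieve (σ : ℝ → ℝ) (d r : ℕ) (V M : ℝ) : Set (EuclideanSpace ℝ (Fin d) → ℝ) :=
  {f | ∃ (α₀ : ℝ) (α : Fin r → ℝ) (γ₀ : Fin r → ℝ) (γ : Fin r → EuclideanSpace ℝ (Fin d)),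
    |α₀| + ∑ j, |α j| ≤ V ∧
    (∀ j, |γ₀ j| + ∑ i, |γ j i| ≤ M) ∧
    f = fun x => α₀ + ∑ j, α j * σ (inner ℝ (γ j) x + γ₀ j)}

/-- The empirical norm `‖f‖ₙ = (n⁻¹ ∑ᵢ f(xᵢ)²)^(1/2)` at the design points `x₁, …, xₙ`. -/
noncomputable def empNorm {d n : ℕ} (x : Fin n → EuclideanSpace ℝ (Fin d))
    (f : EuclideanSpace ℝ (Fin d) → ℝ) : ℝ :=
  Real.sqrt ((1 / (n : ℝ)) * ∑ i, f (x i) ^ 2)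

/-- The generalized least squares loss `n⁻¹ (y - f(x))ᵀ Q (y - f(x))`. -/
noncomputable def glsLoss {d n : ℕ} (Q : Matrix (Fin n) (Fin n) ℝ)
    (x : Fin n → EuclideanSpace ℝ (Fin d)) (y : Fin n → ℝ)
    (f : EuclideanSpace ℝ (Fin d) → ℝ) : ℝ :=
  (1 / (n : ℝ)) * ((fun i => y i - f (x i)) ⬝ᵥ (Q *ᵥ fun i => y i - f (x i)))

/-- The covariance matrix of the random variables `Z₁, …, Zₙ`. -/
noncomputable def covMat {Ω : Type*} [MeasurableSpace Ω] (P : Measure Ω) {n : ℕ}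
    (Z : Fin n → Ω → ℝ) : Matrix (Fin n) (Fin n) ℝ :=
  Matrix.of fun i j => cov[Z i, Z j; P]

end NNGLS

/-! Comparing the loss at the minimizer with its loss at an approximant `g` from the sieve cancels
the pure noise term. What remains bounds the `Q`-quadratic form of `f₀ - fhat` by that of `f₀ - g`
plus twice the difference of the pairings of `Q ε` with `fhat` and `g` (`glsLoss_basic_inequality`).
The spectral hypotheses make the `Q`-form comparable to `n` times the squared empirical norm and
give linear functionals of `Q ε` variance at most a constant times the squared norm of the
coefficients (`quadraticForm_bounds`).

The pairing is controlled uniformly over the sieve without covering numbers. Since `σ` is monotone,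
superlevel sets of a hidden unit are cut out by half-spaces, so by a layer-cake integral the pairing
is at most a constant times `V` times the largest sum of `Q ε` over a half-space trace
(`abs_sum_mul_sieve_le`). Half-spaces have VC dimension at most `d + 1`, so there are only
polynomially many traces. A Gaussian union bound at level `κ n / V n` then succeeds because `V n ^ 2
* log n = o(n)` (`eventually_sq_mul_log_le`).

The approximant comes from `exists_sieve_near`: exponential ridge functions span a dense algebra by
Stone–Weierstrass, and each is a uniform limit of networks by a one-dimensional staircase
construction. -/

namespace NNGLS

/-! ### Spectral bounds for quadratic forms -/

section Matrix

variable {m : Type*} [Fintype m] [DecidableEq m]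

theorem dotProduct_mulVec_le_of_spectrum_le {A : Matrix m m ℝ} (hA : A.IsSymm) {b : ℝ}
    (h : ∀ x ∈ spectrum ℝ A, x ≤ b) (v : m → ℝ) : v ⬝ᵥ (A *ᵥ v) ≤ b * (v ⬝ᵥ v) := by
  have hps : (algebraMap ℝ (Matrix m m ℝ) b - A).PosSemidef := by
    rw [Matrix.posSemidef_iff_isHermitian_and_spectrum_nonneg]
    constructor
    · refine Matrix.IsHermitian.sub ?_ ?_
      · rw [Matrix.algebraMap_eq_diagonal]
        exact Matrix.isHermitian_diagonal _
      · simpa [Matrix.IsHermitian, Matrix.conjTranspose_eq_transpose_of_trivial] using hA.eq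
    · intro x hx
      have : b - x ∈ spectrum ℝ A := by
        rw [← spectrum.singleton_sub_eq] at hx
        obtain ⟨c, hc, y, hy, rfl⟩ := Set.mem_sub.1 hx
        rw [Set.mem_singleton_iff.1 hc]
        simpa using hy
      have := h _ this
      simp only [Set.mem_ofPred_eq]
      linarith
  have := hps.dotProduct_mulVec_nonneg v
  rw [Matrix.sub_mulVec, dotProduct_sub, Algebra.algebraMap_eq_smul_one, Matrix.smul_mulVec,
    Matrix.one_mulVec, dotProduct_smul] at this
  simp only [star_trivial, smul_eq_mul] at this
  linarith

theorem le_dotProduct_mulVec_of_le_spectrum {A : Matrix m m ℝ} (hA : A.IsSymm) {a : ℝ}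
    (h : ∀ x ∈ spectrum ℝ A, a ≤ x) (v : m → ℝ) : a * (v ⬝ᵥ v) ≤ v ⬝ᵥ (A *ᵥ v) := by
  have := dotProduct_mulVec_le_of_spectrum_le (A := -A) hA.neg (b := -a)
    (fun x hx => by
      rw [← spectrum.neg_eq, Set.mem_neg] at hx
      linarith [h _ hx]) v
  rw [Matrix.neg_mulVec, dotProduct_neg] at this
  linarith

/-- With `w = A v`, nonnegativity of the form at `b v - w` together with `A ≤ b` at `w` gives `w·w ≤
b v·w`; then `A ≤ b` at `v` finishes, with no diagonalization. -/
theorem mulVec_dotProduct_mulVec_le_of_spectrum {A : Matrix m m ℝ} (hA : A.IsSymm) {b : ℝ}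
    (hb : 0 < b) (h : spectrum ℝ A ⊆ Set.Icc 0 b) (v : m → ℝ) :
    (A *ᵥ v) ⬝ᵥ (A *ᵥ v) ≤ b ^ 2 * (v ⬝ᵥ v) := by
  set w := A *ᵥ v with hw
  have h1 := dotProduct_mulVec_le_of_spectrum_le hA (fun x hx => (h hx).2) v
  have h2 := dotProduct_mulVec_le_of_spectrum_le hA (fun x hx => (h hx).2) w
  have h3 := le_dotProduct_mulVec_of_le_spectrum hA (fun x hx => (h hx).1) (b • v - w)
  have h4 : v ⬝ᵥ (A *ᵥ w) = w ⬝ᵥ w := by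
    rw [Matrix.dotProduct_mulVec, ← Matrix.mulVec_transpose, hA]
  have h5 : w ⬝ᵥ v = v ⬝ᵥ w := dotProduct_comm _ _
  simp only [Matrix.mulVec_sub, Matrix.mulVec_smul, ← hw, dotProduct_sub, sub_dotProduct,
    smul_dotProduct, dotProduct_smul, h4, smul_eq_mul, zero_mul] at h3
  nlinarith [mul_le_mul_of_nonneg_left h1 (sq_nonneg b)]

/-- The products in the two orders share their nonzero spectrum, and `0 < a` forces `R` to be
invertible, which excludes the eigenvalue zero. -/
theorem spectrum_transpose_mul_self_subset {R : Matrix m m ℝ} {a b : ℝ} (ha : 0 < a)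
    (h : spectrum ℝ (R * Rᵀ) ⊆ Set.Icc a b) :
    IsUnit R ∧ spectrum ℝ (Rᵀ * R) ⊆ Set.Icc a b := by
  have h0 : IsUnit (R * Rᵀ) := by
    rw [← spectrum.zero_notMem_iff ℝ]
    exact fun h0 => absurd (h h0).1 (not_le.2 ha)
  have hR : IsUnit R := by
    rw [Matrix.isUnit_iff_isUnit_det, Matrix.det_mul] at h0
    exact (Matrix.isUnit_iff_isUnit_det R).2 (isUnit_of_mul_isUnit_left h0)
  refine ⟨hR, fun x hx => ?_⟩
  have hRR : IsUnit (Rᵀ * R) := by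
    refine IsUnit.mul ?_ hR
    rw [Matrix.isUnit_iff_isUnit_det, Matrix.det_transpose]
    exact (Matrix.isUnit_iff_isUnit_det R).1 hR
  have hx0 : x ≠ 0 := fun h0 => (spectrum.zero_notMem_iff ℝ).2 hRR (h0 ▸ hx)
  have : x ∈ spectrum ℝ (Rᵀ * R) \ {0} := ⟨hx, hx0⟩
  rw [spectrum.nonzero_mul_comm] at this
  exact h this.1

/-- Bounds for the quadratic form of a precision matrix `Q` and for the covariance matrix `Q Σ Q`
of `Q ε`, where `Σ = R Rᵀ` is the covariance matrix of `ε`, in terms of the spectra of `Σ` and of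
the discrepancy matrix `Rᵀ Q R`. -/
theorem quadraticForm_bounds {Q R : Matrix m m ℝ} {a b lo hi : ℝ} (hQ : Q.IsSymm) (ha : 0 < a)
    (hlo : 0 < lo) (hhi : 0 < hi)
    (hR : spectrum ℝ (R * Rᵀ) ⊆ Set.Icc a b) (hE : spectrum ℝ (Rᵀ * Q * R) ⊆ Set.Ioo lo hi)
    (hb : 0 < b) (v : m → ℝ) :
    lo / b * (v ⬝ᵥ v) ≤ v ⬝ᵥ (Q *ᵥ v) ∧ v ⬝ᵥ (Q *ᵥ v) ≤ hi / a * (v ⬝ᵥ v) ∧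
      (Q *ᵥ v) ⬝ᵥ ((R * Rᵀ) *ᵥ (Q *ᵥ v)) ≤ hi ^ 2 / a * (v ⬝ᵥ v) := by
  obtain ⟨hRu, hS⟩ := spectrum_transpose_mul_self_subset ha hR
  -- In the coordinate `w` all three forms are expressed through `Rᵀ R` and `Rᵀ Q R`, whose spectra
  -- are known.
  obtain ⟨w, rfl⟩ : ∃ w, R *ᵥ w = v := ⟨R⁻¹ *ᵥ v, by
    rw [Matrix.mulVec_mulVec, Matrix.mul_nonsing_inv _ ((Matrix.isUnit_iff_isUnit_det R).1 hRu),
      Matrix.one_mulVec]⟩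
  have hadj : ∀ x y : m → ℝ, (R *ᵥ x) ⬝ᵥ y = x ⬝ᵥ (Rᵀ *ᵥ y) := fun x y => by
    rw [Matrix.dotProduct_mulVec, Matrix.vecMul_transpose]
  have hEs : (Rᵀ * Q * R).IsSymm := by
    simp [Matrix.IsSymm, Matrix.transpose_mul, hQ.eq, Matrix.mul_assoc]
  have hSs : (Rᵀ * R).IsSymm := by simp [Matrix.IsSymm, Matrix.transpose_mul]
  have hvv : (R *ᵥ w) ⬝ᵥ (R *ᵥ w) = w ⬝ᵥ ((Rᵀ * R) *ᵥ w) := by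
    rw [hadj, Matrix.mulVec_mulVec]
  have hvQv : (R *ᵥ w) ⬝ᵥ (Q *ᵥ (R *ᵥ w)) = w ⬝ᵥ ((Rᵀ * Q * R) *ᵥ w) := by
    rw [hadj, Matrix.mulVec_mulVec, Matrix.mulVec_mulVec, Matrix.mul_assoc]
  have hvar : (Q *ᵥ (R *ᵥ w)) ⬝ᵥ ((R * Rᵀ) *ᵥ (Q *ᵥ (R *ᵥ w)))
      = ((Rᵀ * Q * R) *ᵥ w) ⬝ᵥ ((Rᵀ * Q * R) *ᵥ w) := by
    rw [← Matrix.mulVec_mulVec, dotProduct_comm, hadj]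
    simp only [Matrix.mulVec_mulVec, Matrix.mul_assoc]
  rw [hvar, hvQv, hvv]
  have h1 := dotProduct_mulVec_le_of_spectrum_le hSs (fun x hx => (hS hx).2) w
  have h2 := le_dotProduct_mulVec_of_le_spectrum hSs (fun x hx => (hS hx).1) w
  have h3 := dotProduct_mulVec_le_of_spectrum_le hEs (fun x hx => (hE hx).2.le) w
  have h4 := le_dotProduct_mulVec_of_le_spectrum hEs (fun x hx => (hE hx).1.le) w
  have h5 := mulVec_dotProduct_mulVec_le_of_spectrum hEs hhi
    (fun x hx => ⟨(hlo.trans (hE hx).1).le, (hE hx).2.le⟩) w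
  have h6 : w ⬝ᵥ w ≤ (w ⬝ᵥ ((Rᵀ * R) *ᵥ w)) / a := by
    rw [le_div_iff₀ ha]; linarith
  have h7 : (w ⬝ᵥ ((Rᵀ * R) *ᵥ w)) / b ≤ w ⬝ᵥ w := by
    rw [div_le_iff₀ hb]; linarith
  refine ⟨?_, ?_, ?_⟩
  · refine le_trans ?_ h4
    calc _ = lo * ((w ⬝ᵥ ((Rᵀ * R) *ᵥ w)) / b) := by ring
      _ ≤ _ := by gcongr
  · refine h3.trans ?_
    calc _ ≤ hi * ((w ⬝ᵥ ((Rᵀ * R) *ᵥ w)) / a) := by gcongr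
      _ = _ := by ring
  · refine h5.trans ?_
    calc _ ≤ hi ^ 2 * ((w ⬝ᵥ ((Rᵀ * R) *ᵥ w)) / a) := by gcongr
      _ = _ := by ring

end Matrix

/-! ### Half-space traces, their number, and uniform control over the sieve -/

section HalfSpaces

variable {ι : Type*} [Fintype ι]

open Classical in
/-- The index sets cut out by open half-spaces from a finite family of points. -/
noncomputable def halfSpaceTraces {d : ℕ} (x : ι → EuclideanSpace ℝ (Fin d)) :
    Finset (Finset ι) :=
  Finset.univ.filter fun S => ∃ (γ : EuclideanSpace ℝ (Fin d)) (t : ℝ),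
    ∀ i, i ∈ S ↔ t < inner ℝ γ (x i)

theorem mem_halfSpaceTraces {d : ℕ} {x : ι → EuclideanSpace ℝ (Fin d)} {S : Finset ι} :
    S ∈ halfSpaceTraces x ↔ ∃ (γ : EuclideanSpace ℝ (Fin d)) (t : ℝ),
      ∀ i, i ∈ S ↔ t < inner ℝ γ (x i) := by
  simp [halfSpaceTraces]

/-- Radon's argument: `d + 2` points lifted to height one are linearly dependent. A half-space
picking out exactly the positive coefficients would make a vanishing sum consist of nonnegative
terms, one of them positive. -/
theorem card_le_of_shatters_halfSpaceTraces [DecidableEq ι] {d : ℕ}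
    {x : ι → EuclideanSpace ℝ (Fin d)}
    {s : Finset ι} (hs : (halfSpaceTraces x).Shatters s) : s.card ≤ d + 1 := by
  by_contra! hcard
  let w : s → EuclideanSpace ℝ (Fin d) × ℝ := fun i => (x i, 1)
  have hdep : ¬ LinearIndependent ℝ w := fun hli => by
    have := hli.fintype_card_le_finrank
    simp at this
    omega
  rw [Fintype.not_linearIndependent_iff] at hdep
  obtain ⟨g, hg, i₀, hi₀⟩ := hdep
  obtain ⟨c, hc, i₁, hi₁⟩ : ∃ c : s → ℝ, ∑ i, c i • w i = 0 ∧ ∃ i, 0 < c i := by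
    rcases hi₀.lt_or_gt with h | h
    · exact ⟨-g, by simpa only [Pi.neg_apply, neg_smul, Finset.sum_neg_distrib, neg_eq_zero]
        using hg, i₀, by simpa using h⟩
    · exact ⟨g, hg, i₀, h⟩
  obtain ⟨u, hu, hsu⟩ := hs (t := (Finset.univ.filter fun i : s => 0 < c i).map
    (Function.Embedding.subtype _)) (by
      intro i hi
      simp only [Finset.mem_map, Function.Embedding.subtype_apply] at hi
      obtain ⟨a, -, rfl⟩ := hi
      exact a.2)
  obtain ⟨γ, t, hγ⟩ := mem_halfSpaceTraces.1 hu
  have hpos : ∀ i : s, 0 < c i ↔ t < inner ℝ γ (x i) := fun i => by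
    rw [← hγ]
    have := Finset.ext_iff.1 hsu i
    simpa using this.symm
  have hx := congrArg Prod.fst hc
  have h1 := congrArg Prod.snd hc
  simp only [w, Prod.fst_sum, Prod.snd_sum, Prod.smul_fst, Prod.smul_snd, Prod.fst_zero,
    Prod.snd_zero, smul_eq_mul, mul_one] at hx h1
  have hsum : ∑ i, c i * (inner ℝ γ (x i) - t) = 0 := by
    have : inner ℝ γ (∑ i, c i • x i) = 0 := by rw [hx, inner_zero_right]
    simp only [inner_sum, inner_smul_right] at this
    simp only [mul_sub, Finset.sum_sub_distrib, this, ← Finset.sum_mul, h1]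
    ring
  have hnn : ∀ i, 0 ≤ c i * (inner ℝ γ (x i) - t) := fun i => by
    by_cases h : 0 < c i
    · exact mul_nonneg h.le (sub_nonneg.2 ((hpos i).1 h).le)
    · exact mul_nonneg_of_nonpos_of_nonpos (not_lt.1 h)
        (sub_nonpos.2 (not_lt.1 fun h' => h ((hpos i).2 h')))
  have := (Finset.sum_eq_zero_iff_of_nonneg fun i _ => hnn i).1 hsum i₁ (Finset.mem_univ _)
  exact (mul_pos hi₁ (sub_pos.2 ((hpos i₁).1 hi₁))).ne' this

/-- Sauer–Shelah, with each binomial coefficient bounded crudely by a power. -/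
theorem card_halfSpaceTraces_le [DecidableEq ι] {d : ℕ} (x : ι → EuclideanSpace ℝ (Fin d)) :
    (halfSpaceTraces x).card ≤ (d + 2) * (Fintype.card ι + 1) ^ (d + 1) := by
  have hvc : (halfSpaceTraces x).vcDim ≤ d + 1 := Finset.sup_le fun s hs =>
    card_le_of_shatters_halfSpaceTraces (Finset.mem_shatterer.1 hs)
  calc (halfSpaceTraces x).card ≤ (halfSpaceTraces x).shatterer.card :=
        Finset.card_le_card_shatterer _
    _ ≤ ∑ k ∈ Finset.Iic (halfSpaceTraces x).vcDim, (Fintype.card ι).choose k :=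
        Finset.card_shatterer_le_sum_vcDim
    _ ≤ ∑ k ∈ Finset.Iic (d + 1), (Fintype.card ι).choose k :=
        Finset.sum_le_sum_of_subset (Finset.Iic_subset_Iic.2 hvc)
    _ ≤ ∑ k ∈ Finset.Iic (d + 1), (Fintype.card ι + 1) ^ (d + 1) := by
        refine Finset.sum_le_sum fun k hk => ?_
        calc (Fintype.card ι).choose k ≤ Fintype.card ι ^ k := Nat.choose_le_pow _ _
          _ ≤ (Fintype.card ι + 1) ^ k := by gcongr; omega
          _ ≤ _ := Nat.pow_le_pow_right (by omega) (Finset.mem_Iic.1 hk)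
    _ = _ := by simp

theorem univ_mem_halfSpaceTraces {d : ℕ} (x : ι → EuclideanSpace ℝ (Fin d)) :
    Finset.univ ∈ halfSpaceTraces x :=
  mem_halfSpaceTraces.2 ⟨0, -1, by simp⟩

/-- A superlevel set of a monotone function of an affine functional is cut out by a half-space. -/
theorem filter_lt_mem_halfSpaceTraces {d : ℕ} (x : ι → EuclideanSpace ℝ (Fin d)) {σ : ℝ → ℝ}
    (hσ : Monotone σ) (γ : EuclideanSpace ℝ (Fin d)) (c τ : ℝ) :
    (Finset.univ.filter fun i => τ < σ (inner ℝ γ (x i) + c)) ∈ halfSpaceTraces x := by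
  by_cases hne : (Finset.univ.filter fun i => ¬ τ < σ (inner ℝ γ (x i) + c)).Nonempty
  -- The threshold is the largest inner product among the points outside the superlevel set, so `σ`
  -- need not be inverted.
  · obtain ⟨j, hj, hmax⟩ := Finset.exists_max_image _ (fun i => (inner ℝ γ (x i) : ℝ)) hne
    refine mem_halfSpaceTraces.2 ⟨γ, inner ℝ γ (x j), fun i => ?_⟩
    simp only [Finset.mem_filter, Finset.mem_univ, true_and] at hj hmax ⊢
    constructor
    · intro hi
      by_contra! hle
      exact hj (hi.trans_le (hσ (by linarith)))
    · intro hi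
      by_contra hi'
      exact absurd (hmax i hi') (not_le.2 hi)
  · have : (Finset.univ.filter fun i => τ < σ (inner ℝ γ (x i) + c)) = Finset.univ := by
      ext i
      simp only [Finset.mem_filter, Finset.mem_univ, true_and, iff_true]
      by_contra hi
      exact hne ⟨i, by simpa using hi⟩
    rw [this]
    exact univ_mem_halfSpaceTraces x

/-- A linear functional of a vector with entries in `[a, b]` is controlled by its values at the
indicators of the superlevel sets of the vector. -/
theorem abs_sum_mul_sub_le_of_superlevel (z v : ι → ℝ) {a b W : ℝ} (hab : a ≤ b)
    (hv : ∀ i, v i ∈ Set.Icc a b)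
    (hW : ∀ τ, |∑ i ∈ Finset.univ.filter (fun i => τ < v i), z i| ≤ W) :
    |∑ i, z i * (v i - a)| ≤ (b - a) * W := by
  -- Layer cake: `v i - a` is the length of the set of levels in `(a, b]` lying below `v i`.
  have hint : ∀ i, ∫ τ in Set.Ioc a b, (if τ < v i then z i else 0) = z i * (v i - a) := fun i => by
    have : (fun τ => if τ < v i then z i else 0) = (Set.Iio (v i)).indicator fun _ => z i := by
      ext τ; simp [Set.indicator]
    rw [this, setIntegral_indicator measurableSet_Iio]
    have h2 : Set.Ioc a b ∩ Set.Iio (v i) = Set.Ioo a (v i) := by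
      ext τ
      simp only [Set.mem_inter_iff, Set.mem_Ioc, Set.mem_Iio, Set.mem_Ioo]
      exact ⟨fun h => ⟨h.1.1, h.2⟩, fun h => ⟨⟨h.1, h.2.le.trans (hv i).2⟩, h.2⟩⟩
    rw [h2, setIntegral_const, Real.volume_real_Ioo_of_le (hv i).1, smul_eq_mul, mul_comm]
  have hI : ∀ i, IntegrableOn (fun τ => if τ < v i then z i else 0) (Set.Ioc a b) := fun i => by
    have : (fun τ => if τ < v i then z i else 0) = (Set.Iio (v i)).indicator fun _ => z i := by
      ext τ; simp [Set.indicator]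
    rw [this]
    exact (integrableOn_const (by simp)).indicator measurableSet_Iio
  have hsum : ∑ i, z i * (v i - a)
      = ∫ τ in Set.Ioc a b, ∑ i ∈ Finset.univ.filter (fun i => τ < v i), z i := by
    simp only [← hint, Finset.sum_filter]
    rw [integral_finsetSum _ fun i _ => hI i]
  rw [hsum]
  have := norm_setIntegral_le_of_norm_le_const (μ := volume) (s := Set.Ioc a b)
    (f := fun τ => ∑ i ∈ Finset.univ.filter (fun i => τ < v i), z i) (C := W) (by simp)
    (fun τ _ => hW τ)
  rwa [Real.volume_real_Ioc_of_le hab, Real.norm_eq_abs, mul_comm] at this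

/-- Uniform control over the sieve of a linear functional of the values at the design points, by its
values at the indicators of half-spaces. -/
theorem abs_sum_mul_sieve_le {d r : ℕ} {V M rb : ℝ} {L : ℝ≥0} {σ : ℝ → ℝ}
    (hσ : IsActivation σ rb L) (x : ι → EuclideanSpace ℝ (Fin d)) (z : ι → ℝ) {W : ℝ}
    (hW : ∀ S ∈ halfSpaceTraces x, |∑ i ∈ S, z i| ≤ W)
    {f : EuclideanSpace ℝ (Fin d) → ℝ} (hf : f ∈ sieve σ d r V M) :
    |∑ i, z i * f (x i)| ≤ V * ((1 + 3 * rb) * W) := by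
  have hrb : -rb ≤ rb := (hσ.bounded 0).1.trans (hσ.bounded 0).2
  have hrb0 : 0 ≤ rb := by linarith
  have h1 : |∑ i, z i| ≤ W := hW _ (univ_mem_halfSpaceTraces x)
  have hW0 : 0 ≤ W := (abs_nonneg _).trans h1
  have hunit : ∀ γ c, |∑ i, z i * σ (inner ℝ γ (x i) + c)| ≤ 3 * rb * W := fun γ c => by
    have := abs_sum_mul_sub_le_of_superlevel z (fun i => σ (inner ℝ γ (x i) + c)) hrb
      (fun i => hσ.bounded _)
      (fun τ => hW _ (filter_lt_mem_halfSpaceTraces x hσ.monotone γ c τ))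
    -- Recentring at `-rb` costs `rb` times the full sum, itself a half-space sum; hence `2 rb + rb
    -- = 3 rb`.
    have h2 : ∑ i, z i * σ (inner ℝ γ (x i) + c)
        = ∑ i, z i * (σ (inner ℝ γ (x i) + c) - -rb) - rb * ∑ i, z i := by
      rw [Finset.mul_sum, ← Finset.sum_sub_distrib]
      exact Finset.sum_congr rfl fun i _ => by ring
    rw [h2]
    calc _ ≤ |∑ i, z i * (σ (inner ℝ γ (x i) + c) - -rb)| + |rb * ∑ i, z i| := abs_sub _ _
      _ ≤ (rb - -rb) * W + rb * W := by
        rw [abs_mul, abs_of_nonneg hrb0]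
        gcongr
      _ = _ := by ring
  obtain ⟨α₀, α, γ₀, γ, hα, -, rfl⟩ := hf
  have hexp : ∑ i, z i * (α₀ + ∑ j, α j * σ (inner ℝ (γ j) (x i) + γ₀ j))
      = α₀ * ∑ i, z i + ∑ j, α j * ∑ i, z i * σ (inner ℝ (γ j) (x i) + γ₀ j) := by
    simp only [mul_add, Finset.sum_add_distrib, Finset.mul_sum]
    rw [Finset.sum_comm (s := Finset.univ (α := Fin r))]
    congr 1
    · exact Finset.sum_congr rfl fun i _ => mul_comm _ _
    · exact Finset.sum_congr rfl fun i _ => Finset.sum_congr rfl fun j _ => by ring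
  have hB : 3 * rb * W ≤ (1 + 3 * rb) * W := by nlinarith
  have hB1 : W ≤ (1 + 3 * rb) * W := by nlinarith [mul_nonneg hrb0 hW0]
  simp only [hexp]
  calc |α₀ * ∑ i, z i + ∑ j, α j * ∑ i, z i * σ (inner ℝ (γ j) (x i) + γ₀ j)|
      ≤ |α₀ * ∑ i, z i| + ∑ j, |α j * ∑ i, z i * σ (inner ℝ (γ j) (x i) + γ₀ j)| :=
        (abs_add_le _ _).trans (by gcongr; exact Finset.abs_sum_le_sum_abs _ _)
    _ ≤ |α₀| * ((1 + 3 * rb) * W) + ∑ j, |α j| * ((1 + 3 * rb) * W) := by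
        simp only [abs_mul]
        gcongr
        · exact h1.trans hB1
        · exact (hunit _ _).trans hB
    _ = (|α₀| + ∑ j, |α j|) * ((1 + 3 * rb) * W) := by rw [← Finset.sum_mul]; ring
    _ ≤ _ := by
        have : 0 ≤ (1 + 3 * rb) * W := hW0.trans hB1
        gcongr

end HalfSpaces

end NNGLS

namespace NNGLS

/-! ### Gaussian tails and the union bound -/

section GaussianTail

variable {Ω : Type*} [MeasurableSpace Ω] {P : Measure Ω}

theorem measureReal_abs_ge_le_of_hasGaussianLaw [IsProbabilityMeasure P] {Z : Ω → ℝ} (hZ : HasGaussianLaw Z P)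
    (hmean : ∫ ω, Z ω ∂P = 0) {v W : ℝ} (hvar : Var[Z; P] ≤ v) (hW : 0 ≤ W) :
    P.real {ω | W ≤ |Z ω|} ≤ 2 * Real.exp (-W ^ 2 / (2 * v)) := by
  lift v to ℝ≥0 using (variance_nonneg _ _).trans hvar
  have hmap := hZ.map_eq_gaussianReal
  rw [hmean] at hmap
  have hsub : HasSubgaussianMGF Z v P := by
    refine ⟨fun t => ?_, fun t => ?_⟩
    · rw [← mgf_pos_iff, mgf_gaussianReal hmap]
      exact Real.exp_pos _
    · rw [mgf_gaussianReal hmap, Real.coe_toNNReal _ (variance_nonneg _ _)]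
      simp only [zero_mul, zero_add]
      gcongr
  have h1 := hsub.measure_ge_le hW
  have h2 := hsub.neg.measure_ge_le hW
  calc P.real {ω | W ≤ |Z ω|} ≤ P.real ({ω | W ≤ Z ω} ∪ {ω | W ≤ (-Z) ω}) :=
        measureReal_mono (fun ω hω => by
          simpa only [Set.mem_union, Set.mem_ofPred_eq, Pi.neg_apply, ← le_abs] using hω)
    _ ≤ _ := measureReal_union_le _ _
    _ ≤ 2 * Real.exp (-W ^ 2 / (2 * v)) := by
        linarith

variable {n : ℕ} {ε : Fin n → Ω → ℝ}

theorem covMat_add_const [IsProbabilityMeasure P] (hε : IsGaussianProcess ε P) {Y : Fin n → Ω → ℝ} {c : Fin n → ℝ}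
    (hY : ∀ i ω, Y i ω = c i + ε i ω) : covMat P Y = covMat P ε := by
  have hint : ∀ i, Integrable (ε i) P := fun i => (hε.hasGaussianLaw_eval i).integrable
  have hY' : ∀ i, Y i = fun ω => c i + ε i ω := fun i => funext (hY i)
  ext i j
  simp only [covMat, Matrix.of_apply, hY']
  rw [covariance_const_add_left (hint i), covariance_const_add_right (hint j)]

theorem hasGaussianLaw_sum_mul (hε : IsGaussianProcess ε P) (c : Fin n → ℝ) :
    HasGaussianLaw (fun ω => ∑ i, c i * ε i ω) P := by
  simpa using (hε.smul c).hasGaussianLaw_fun_sum (I := Finset.univ)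

theorem integral_sum_mul (hε : IsGaussianProcess ε P) (hmean : ∀ i, ∫ ω, ε i ω ∂P = 0)
    (c : Fin n → ℝ) : ∫ ω, ∑ i, c i * ε i ω ∂P = 0 := by
  rw [integral_finsetSum _ fun i _ => ((hε.hasGaussianLaw_eval i).integrable).const_mul _]
  simp [integral_const_mul, hmean]

theorem variance_sum_mul [IsProbabilityMeasure P] (hε : IsGaussianProcess ε P) (c : Fin n → ℝ) :
    Var[fun ω => ∑ i, c i * ε i ω; P] = c ⬝ᵥ (covMat P ε *ᵥ c) := by
  have hL : ∀ i, MemLp (fun ω => c i * ε i ω) 2 P := fun i =>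
    ((hε.hasGaussianLaw_eval i).memLp_two).const_mul _
  rw [← covariance_self (hasGaussianLaw_sum_mul hε c).aemeasurable,
    covariance_fun_sum_fun_sum hL hL]
  simp only [covariance_const_mul_left, covariance_const_mul_right, dotProduct, Matrix.mulVec,
    covMat, Matrix.of_apply, Finset.mul_sum]
  exact Finset.sum_congr rfl fun i _ => Finset.sum_congr rfl fun j _ => by ring

/-- A maximal inequality for the partial sums of `Q ε` over a finite family of index sets. -/
theorem measure_exists_abs_sum_ge_le [IsProbabilityMeasure P] (hε : IsGaussianProcess ε P)
    (hmean : ∀ i, ∫ ω, ε i ω ∂P = 0) {Q : Matrix (Fin n) (Fin n) ℝ} (hQ : Q.IsSymm) {C : ℝ}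
    (hC : 0 ≤ C)
    (hvar : ∀ v, (Q *ᵥ v) ⬝ᵥ (covMat P ε *ᵥ (Q *ᵥ v)) ≤ C * (v ⬝ᵥ v))
    (H : Finset (Finset (Fin n))) {W : ℝ} (hW : 0 ≤ W) :
    P {ω | ∃ S ∈ H, W ≤ |∑ i ∈ S, (Q *ᵥ fun j => ε j ω) i|} ≤
      ENNReal.ofReal (H.card * (2 * Real.exp (-W ^ 2 / (2 * (C * n))))) := by
  have hone : ∀ S ∈ H, P.real {ω | W ≤ |∑ i ∈ S, (Q *ᵥ fun j => ε j ω) i|}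
      ≤ 2 * Real.exp (-W ^ 2 / (2 * (C * n))) := fun S _ => by
    -- By symmetry of `Q`, the sum over `S` is the pairing of `ε` with `Q` applied to the indicator
    -- of `S`, whose squared norm is at most `n`.
    let v : Fin n → ℝ := fun i => if i ∈ S then 1 else 0
    have hsum : ∀ ω, ∑ i ∈ S, (Q *ᵥ fun j => ε j ω) i = ∑ i, (Q *ᵥ v) i * ε i ω := fun ω => by
      change _ = (Q *ᵥ v) ⬝ᵥ (fun j => ε j ω)
      rw [dotProduct_comm, Matrix.dotProduct_mulVec, ← Matrix.mulVec_transpose, hQ.eq,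
        dotProduct_comm]
      simp [v, dotProduct]
    have hvv : v ⬝ᵥ v ≤ n := by
      calc v ⬝ᵥ v ≤ ∑ _i : Fin n, (1 : ℝ) := Finset.sum_le_sum fun i _ => by
            by_cases h : i ∈ S <;> simp [v, h]
        _ = n := by simp
    simp only [hsum]
    refine measureReal_abs_ge_le_of_hasGaussianLaw (hasGaussianLaw_sum_mul hε _)
      (integral_sum_mul hε hmean _) ?_ hW
    rw [variance_sum_mul hε]
    exact (hvar v).trans (by gcongr)
  have hunion : {ω | ∃ S ∈ H, W ≤ |∑ i ∈ S, (Q *ᵥ fun j => ε j ω) i|}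
      = ⋃ S ∈ H, {ω | W ≤ |∑ i ∈ S, (Q *ᵥ fun j => ε j ω) i|} := by
    ext ω; simp
  rw [← ofReal_measureReal]
  refine ENNReal.ofReal_le_ofReal ?_
  rw [hunion]
  refine (measureReal_biUnion_finset_le _ _).trans ?_
  refine (Finset.sum_le_sum hone).trans ?_
  simp

end GaussianTail

/-! ### Consequences of the growth condition -/

section Rates

/-- The hypothesis involves `log (V r)` rather than `log n`. If `V r` is at least `(n + 1)^(1/4)`,
the two logarithms are comparable; otherwise `V ^ 2` is below `(n + 1)^(1/2)` and `log n =
o(n^(1/2))` suffices. -/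
theorem eventually_sq_mul_log_le {r : ℕ → ℕ} {V : ℕ → ℝ} (hr : Tendsto r atTop atTop)
    (hV : Tendsto V atTop atTop)
    (hscale : (fun n => (r n : ℝ) * V n ^ 2 * Real.log (V n * r n)) =o[atTop]
      fun n : ℕ => (n : ℝ)) {ρ : ℝ} (hρ : 0 < ρ) :
    ∀ᶠ n : ℕ in atTop, V n ^ 2 * Real.log (n + 1) ≤ ρ * n := by
  have hlog : ∀ᶠ n : ℕ in atTop,
      Real.log ((n : ℝ) + 1) ≤ (ρ / 2) * ((n : ℝ) + 1) ^ (1 / 2 : ℝ) := by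
    have h := (isLittleO_log_rpow_atTop (r := 1 / 2) (by norm_num)).bound (half_pos hρ)
    have ht : Tendsto (fun n : ℕ => (n : ℝ) + 1) atTop atTop :=
      tendsto_atTop_add_const_right _ _ tendsto_natCast_atTop_atTop
    filter_upwards [ht.eventually h] with n hn
    refine (le_abs_self _).trans (hn.trans_eq ?_)
    rw [Real.norm_of_nonneg (by positivity)]
  filter_upwards [hscale.bound (show 0 < ρ / 4 by positivity), hlog, hr.eventually_ge_atTop 1,
    hV.eventually_ge_atTop 1, eventually_ge_atTop 1] with n hn hlogn hrn hVn hn1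
  have hn1' : (1 : ℝ) ≤ n := by exact_mod_cast hn1
  have hr1 : (1 : ℝ) ≤ r n := by exact_mod_cast hrn
  have hlog0 : 0 ≤ Real.log ((n : ℝ) + 1) := Real.log_nonneg (by linarith)
  have hVr : V n ≤ V n * r n := le_mul_of_one_le_right (by linarith) hr1
  by_cases hcase : ((n : ℝ) + 1) ^ (1 / 4 : ℝ) ≤ V n * r n
  · have h1 : 1 / 4 * Real.log ((n : ℝ) + 1) ≤ Real.log (V n * r n) := by
      rw [← Real.log_rpow (by positivity)]
      exact Real.log_le_log (by positivity) hcase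
    have h2 : (r n : ℝ) * V n ^ 2 * Real.log (V n * r n) ≤ ρ / 4 * n := by
      refine (le_abs_self _).trans (hn.trans_eq ?_)
      rw [Real.norm_of_nonneg (by positivity)]
    have h3 : V n ^ 2 * (1 / 4 * Real.log ((n : ℝ) + 1))
        ≤ (r n : ℝ) * V n ^ 2 * Real.log (V n * r n) := by
      gcongr
      exact le_mul_of_one_le_left (by positivity) hr1
    linarith
  · push Not at hcase
    have hV2 : V n ^ 2 ≤ ((n : ℝ) + 1) ^ (1 / 2 : ℝ) := by
      have h : V n ≤ ((n : ℝ) + 1) ^ (1 / 4 : ℝ) := hVr.trans hcase.le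
      calc V n ^ 2 ≤ (((n : ℝ) + 1) ^ (1 / 4 : ℝ)) ^ 2 := by gcongr
        _ = ((n : ℝ) + 1) ^ (1 / 2 : ℝ) := by
          rw [← Real.rpow_natCast, ← Real.rpow_mul (by positivity)]
          norm_num
    calc V n ^ 2 * Real.log (n + 1)
        ≤ ((n : ℝ) + 1) ^ (1 / 2 : ℝ) * ((ρ / 2) * ((n : ℝ) + 1) ^ (1 / 2 : ℝ)) := by gcongr
      _ = ρ / 2 * ((n : ℝ) + 1) := by
          have : ((n : ℝ) + 1) ^ (1 / 2 : ℝ) * ((n : ℝ) + 1) ^ (1 / 2 : ℝ) = (n : ℝ) + 1 := by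
            rw [← Real.rpow_add (by positivity)]; norm_num
          linear_combination (ρ / 2) * this
      _ ≤ ρ * n := by nlinarith

/-- A Gaussian tail at level `κ n / Vₙ` beats any polynomial. -/
theorem tendsto_pow_mul_exp_neg {V : ℕ → ℝ} (hVpos : ∀ n, 0 < V n)
    (hrate : ∀ ρ : ℝ, 0 < ρ → ∀ᶠ n : ℕ in atTop, V n ^ 2 * Real.log (n + 1) ≤ ρ * n)
    {κ C : ℝ} (hκ : 0 < κ) (hC : 0 < C) (A : ℝ) (hA : 0 ≤ A) (D : ℕ) :
    Tendsto (fun n : ℕ => A * ((n : ℝ) + 1) ^ D *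
      (2 * Real.exp (-(κ * n / V n) ^ 2 / (2 * (C * n))))) atTop (𝓝 0) := by
  have hup : Tendsto (fun n : ℕ => (A * 2) * (1 / ((n : ℝ) + 1))) atTop (𝓝 0) := by
    simpa using tendsto_one_div_add_atTop_nhds_zero_nat.const_mul (A * 2)
  refine squeeze_zero' (Eventually.of_forall fun n => by positivity) ?_ hup
  -- This `ρ` makes the exponent at least `(D + 1) log (n + 1)`, one power more than the prefactor.
  filter_upwards [hrate (κ ^ 2 / (2 * C * (D + 1))) (by positivity), eventually_ge_atTop 1]
    with n hn hn1
  have hn0 : (0 : ℝ) < n := by exact_mod_cast hn1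
  have hV := hVpos n
  have hexp : Real.exp (-(κ * n / V n) ^ 2 / (2 * (C * n))) ≤ (((n : ℝ) + 1) ^ (D + 1))⁻¹ := by
    rw [← Real.exp_log (show (0 : ℝ) < (((n : ℝ) + 1) ^ (D + 1))⁻¹ by positivity), Real.log_inv,
      Real.log_pow, Real.exp_le_exp]
    have h1 : -(κ * n / V n) ^ 2 / (2 * (C * n)) = -(κ ^ 2 * n / (2 * C * V n ^ 2)) := by
      field_simp
    rw [h1, neg_le_neg_iff, le_div_iff₀ (by positivity)]
    have h2 : κ ^ 2 / (2 * C * (D + 1)) * n * (2 * C * (D + 1)) = κ ^ 2 * n := by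
      field_simp
    have h3 := mul_le_mul_of_nonneg_right hn (show 0 ≤ 2 * C * ((D : ℝ) + 1) by positivity)
    rw [h2] at h3
    push_cast
    linarith
  calc A * ((n : ℝ) + 1) ^ D * (2 * Real.exp (-(κ * n / V n) ^ 2 / (2 * (C * n))))
      ≤ A * ((n : ℝ) + 1) ^ D * (2 * (((n : ℝ) + 1) ^ (D + 1))⁻¹) := by gcongr
    _ = (A * 2) * (1 / ((n : ℝ) + 1)) := by
        rw [pow_succ]
        field_simp

end Rates

end NNGLS

namespace NNGLS

/-! ### Universal approximation by the sieve -/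

section UniversalApproximation

/-- A continuous monotone function on an interval is a uniform limit of combinations of translates
of a sharply scaled sigmoid. -/
theorem exists_sum_unit_sigmoid_near {s : ℝ → ℝ} (hs : ∀ t, s t ∈ Set.Icc (0 : ℝ) 1)
    (hbot : Tendsto s atBot (𝓝 0)) (htop : Tendsto s atTop (𝓝 1)) {h : ℝ → ℝ}
    (hm : Monotone h) (hc : Continuous h) {a b : ℝ} (hab : a < b) {η : ℝ} (hη : 0 < η) :
    ∃ (N : ℕ) (k : ℝ) (c t : ℕ → ℝ), ∀ u ∈ Set.Icc a b,
      |h u - (h a + ∑ j ∈ Finset.range N, c j * s (k * u + t j))| ≤ η := by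
  have huc := isCompact_Icc.uniformContinuousOn_of_continuous (hc.continuousOn (s := Set.Icc a b))
  rw [Metric.uniformContinuousOn_iff] at huc
  obtain ⟨δ₀, hδ₀, huc⟩ := huc (η / 4) (by positivity)
  obtain ⟨N, hN⟩ := exists_nat_gt ((b - a) / δ₀)
  have hba : 0 < b - a := sub_pos.2 hab
  have hN0 : (0 : ℝ) < N := (div_pos hba hδ₀).trans hN
  set δ : ℝ := (b - a) / N with hδ
  have hδpos : 0 < δ := div_pos hba hN0
  have hδlt : δ < δ₀ := by rwa [hδ, div_lt_comm₀ hN0 hδ₀]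
  have hNδ : N * δ = b - a := by rw [hδ]; field_simp
  let p : ℕ → ℝ := fun j => a + j * δ
  have hpsucc : ∀ j, p (j + 1) = p j + δ := fun j => by simp only [p]; push_cast; ring
  have hpN : p N = b := by simp only [p, hNδ]; ring
  have hpmem : ∀ j ≤ N, p j ∈ Set.Icc a b := fun j hj => by
    have : (j : ℝ) * δ ≤ N * δ := by gcongr
    exact ⟨by simp only [p]; have : 0 ≤ (j : ℝ) * δ := by positivity
              linarith, by simp only [p]; linarith⟩
  let Δ : ℕ → ℝ := fun j => h (p (j + 1)) - h (p j)
  have hΔ0 : ∀ j, 0 ≤ Δ j := fun j => sub_nonneg.2 (hm (by rw [hpsucc]; linarith))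
  have hΔ : ∀ j < N, Δ j ≤ η / 4 := fun j hj => by
    have := huc _ (hpmem (j + 1) hj) _ (hpmem j hj.le) (by
      rw [hpsucc, Real.dist_eq]; simpa [abs_of_pos hδpos] using hδlt)
    rw [Real.dist_eq] at this
    exact (le_abs_self _).trans this.le
  have hΔsum : ∑ j ∈ Finset.range N, Δ j = h b - h a := by
    rw [Finset.sum_range_sub (fun j => h (p j)), hpN]
    simp [p]
  have hhab : 0 ≤ h b - h a := sub_nonneg.2 (hm hab.le)
  -- Weighted by the increments of `h`, which total `h b - h a`, errors of size `η'` add up to at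
  -- most `η / 2`.
  set η' : ℝ := η / (2 * (h b - h a + 1)) with hη'
  have hη'pos : 0 < η' := by positivity
  obtain ⟨B₁, hB₁⟩ := eventually_atBot.1 (hbot.eventually (ge_mem_nhds hη'pos))
  obtain ⟨B₂, hB₂⟩ := eventually_atTop.1 (htop.eventually
    (le_mem_nhds (show 1 - η' < 1 by linarith)))
  -- Steep enough that, at distance one mesh width from its centre, each sigmoid is within `η'` of
  -- its limit.
  set k : ℝ := max (max (-B₁) B₂) 0 / δ with hk
  have hkδ : k * δ = max (max (-B₁) B₂) 0 := by rw [hk]; field_simp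
  have hk0 : 0 ≤ k := div_nonneg (le_max_right _ _) hδpos.le
  have hlow : ∀ y ≤ -δ, s (k * y) ≤ η' := fun y hy => hB₁ _ (by
    have : k * y ≤ k * (-δ) := by gcongr
    have h1 : -B₁ ≤ k * δ := hkδ ▸ (le_max_left _ _).trans (le_max_left _ _)
    linarith)
  have hhigh : ∀ y ≥ δ, 1 - η' ≤ s (k * y) := fun y hy => hB₂ _ (by
    have : k * δ ≤ k * y := by gcongr
    have h1 : B₂ ≤ k * δ := hkδ ▸ (le_max_right _ _).trans (le_max_left _ _)
    linarith)
  refine ⟨N, k, Δ, fun j => -(k * p j), fun u hu => ?_⟩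
  -- The part of the `j`-th increment of `h` already accumulated at `u`: all of it well to the right
  -- of the grid point, none well to the left.
  let D : ℕ → ℝ := fun j => h (min u (p (j + 1))) - h (min u (p j))
  have hDsum : ∑ j ∈ Finset.range N, D j = h u - h a := by
    rw [Finset.sum_range_sub (fun j => h (min u (p j))), hpN, min_eq_left hu.2]
    simp [p, min_eq_right hu.1]
  let near : Finset ℕ := (Finset.range N).filter fun j => |u - p j| < δ
  have hterm : ∀ j ∈ Finset.range N, |D j - Δ j * s (k * u + -(k * p j))|
      ≤ η' * Δ j + if |u - p j| < δ then η / 4 else 0 := fun j hj => by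
    have hjN := Finset.mem_range.1 hj
    have harg : k * u + -(k * p j) = k * (u - p j) := by ring
    rw [harg]
    have hs1 := hs (k * (u - p j))
    have hd := hΔ0 j
    split_ifs with hnear
    · have hD0 : 0 ≤ D j := sub_nonneg.2 (hm (min_le_min_left _ (by rw [hpsucc]; linarith)))
      have hD1 : D j ≤ Δ j := by
        simp only [D, Δ]
        rcases le_total u (p j) with hup | hup
        · rw [min_eq_left hup, min_eq_left (hup.trans (by rw [hpsucc]; linarith))]
          rw [sub_self]
          exact hd
        · rw [min_eq_right hup]
          exact sub_le_sub_right (hm (min_le_right _ _)) _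
      have h1 : Δ j * s (k * (u - p j)) ≤ Δ j := mul_le_of_le_one_right hd hs1.2
      have h2 : 0 ≤ Δ j * s (k * (u - p j)) := mul_nonneg hd hs1.1
      have h3 := hΔ j hjN
      have h4 := mul_nonneg hη'pos.le hd
      rw [abs_le]
      constructor <;> linarith
    · rw [not_lt, le_abs] at hnear
      rw [add_zero]
      rcases hnear with hge | hle
      · have hDj : D j = Δ j := by
          simp only [D, Δ]
          rw [min_eq_right (by rw [hpsucc]; linarith), min_eq_right (by linarith)]
        have := hhigh _ hge
        rw [hDj, abs_le]
        constructor <;> nlinarith [hs1.2]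
      · have hDj : D j = 0 := by
          simp only [D]
          rw [min_eq_left (by rw [hpsucc]; linarith), min_eq_left (by linarith), sub_self]
        have := hlow (u - p j) (by linarith)
        rw [hDj, abs_le]
        constructor <;> nlinarith [hs1.1]
  -- An open interval of length `2 δ` contains at most two points of a grid of mesh `δ`; their error
  -- is the other `η / 2`.
  have hnear_card : near.card ≤ 2 := by
    let m : ℤ := ⌊(u - a) / δ⌋
    have hsub : near.image (fun j : ℕ => (j : ℤ)) ⊆ {m, m + 1} := by
      intro z hz
      obtain ⟨j, hj, rfl⟩ := Finset.mem_image.1 hz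
      have habs := (Finset.mem_filter.1 hj).2
      rw [abs_lt] at habs
      simp only [p] at habs
      have h1 : (j : ℝ) - 1 < (u - a) / δ := by rw [lt_div_iff₀ hδpos]; linarith
      have h2 : (u - a) / δ < j + 1 := by rw [div_lt_iff₀ hδpos]; linarith
      have h3 : m < j + 1 := by rw [Int.floor_lt]; push_cast; exact h2
      have h4 : (j : ℤ) - 1 ≤ m := by rw [Int.le_floor]; push_cast; exact h1.le
      simp only [Finset.mem_insert, Finset.mem_singleton]
      omega
    calc near.card = (near.image (fun j : ℕ => (j : ℤ))).card :=
          (Finset.card_image_of_injective _ Nat.cast_injective).symm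
      _ ≤ _ := Finset.card_le_card hsub
      _ ≤ 2 := Finset.card_le_two
  have hdecomp : h u - (h a + ∑ j ∈ Finset.range N, Δ j * s (k * u + -(k * p j)))
      = ∑ j ∈ Finset.range N, (D j - Δ j * s (k * u + -(k * p j))) := by
    rw [Finset.sum_sub_distrib, hDsum]; ring
  rw [hdecomp]
  refine (Finset.abs_sum_le_sum_abs _ _).trans ((Finset.sum_le_sum hterm).trans ?_)
  rw [Finset.sum_add_distrib, ← Finset.mul_sum, hΔsum, ← Finset.sum_filter, Finset.sum_const,
    nsmul_eq_mul]
  have h1 : η' * (h b - h a) ≤ η / 2 := by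
    have : η' * (h b - h a + 1) = η / 2 := by rw [hη']; field_simp
    linarith
  have h2 : (near.card : ℝ) * (η / 4) ≤ 2 * (η / 4) := by
    gcongr; exact_mod_cast hnear_card
  have h3 : (near.card : ℝ) * (η / 4) ≤ η / 2 := by linarith
  linarith

/-- A bounded monotone nonconstant `σ` converges to distinct limits at both ends, so an affine
change of its values reduces to limits zero and one. -/
theorem exists_sum_activation_near {σ : ℝ → ℝ} {rb : ℝ} {L : ℝ≥0} (hσ : IsActivation σ rb L)
    {h : ℝ → ℝ} (hm : Monotone h) (hc : Continuous h) {a b : ℝ} (hab : a < b) {η : ℝ}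
    (hη : 0 < η) :
    ∃ (N : ℕ) (k c₀ : ℝ) (c t : ℕ → ℝ), ∀ u ∈ Set.Icc a b,
      |h u - (c₀ + ∑ j ∈ Finset.range N, c j * σ (k * u + t j))| ≤ η := by
  have hba : BddAbove (Set.range σ) := ⟨rb, by rintro _ ⟨t, rfl⟩; exact (hσ.bounded t).2⟩
  have hbb : BddBelow (Set.range σ) := ⟨-rb, by rintro _ ⟨t, rfl⟩; exact (hσ.bounded t).1⟩
  set hi := ⨆ t, σ t with hhi
  set lo := ⨅ t, σ t with hlo
  have htop : Tendsto σ atTop (𝓝 hi) := tendsto_atTop_ciSup hσ.monotone hba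
  have hbot : Tendsto σ atBot (𝓝 lo) := tendsto_atBot_ciInf hσ.monotone hbb
  have hle : ∀ t, σ t ≤ hi := fun t => le_ciSup hba t
  have hge : ∀ t, lo ≤ σ t := fun t => ciInf_le hbb t
  have hlt : lo < hi := by
    obtain ⟨x, y, hxy⟩ := hσ.nonconstant
    rcases hxy.lt_or_gt with h | h
    · exact (hge x).trans_lt (h.trans_le (hle y))
    · exact (hge y).trans_lt (h.trans_le (hle x))
  have hpos : 0 < hi - lo := sub_pos.2 hlt
  obtain ⟨N, k, c, t, hN⟩ := exists_sum_unit_sigmoid_near (s := fun t => (σ t - lo) / (hi - lo))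
    (fun t => ⟨div_nonneg (sub_nonneg.2 (hge t)) hpos.le,
      (div_le_one hpos).2 (sub_le_sub_right (hle t) _)⟩)
    (by simpa using (hbot.sub_const lo).div_const (hi - lo))
    (by simpa [hpos.ne'] using (htop.sub_const lo).div_const (hi - lo)) hm hc hab hη
  refine ⟨N, k, h a - ∑ j ∈ Finset.range N, c j * lo / (hi - lo), fun j => c j / (hi - lo), t,
    fun u hu => ?_⟩
  convert hN u hu using 3
  rw [sub_add, ← Finset.sum_sub_distrib, sub_eq_add_neg, ← Finset.sum_neg_distrib]
  congr 1
  exact Finset.sum_congr rfl fun j _ => by ring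

variable {d : ℕ} {K : Set (EuclideanSpace ℝ (Fin d))}

/-- A single hidden unit, as a continuous function on the domain. -/
noncomputable def unitMap (K : Set (EuclideanSpace ℝ (Fin d))) {σ : ℝ → ℝ} (hσ : Continuous σ)
    (q : EuclideanSpace ℝ (Fin d) × ℝ) : C(K, ℝ) :=
  ⟨fun x => σ (inner ℝ q.1 (x : EuclideanSpace ℝ (Fin d)) + q.2), by fun_prop⟩

/-- The linear span of the constants and of the hidden units. -/
noncomputable def networkSpan (K : Set (EuclideanSpace ℝ (Fin d))) {σ : ℝ → ℝ} (hσ : Continuous σ) :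
    Submodule ℝ C(K, ℝ) :=
  Submodule.span ℝ (insert 1 (Set.range (unitMap K hσ)))

/-- The exponential ridge function in the direction `γ`. -/
noncomputable def expRidge (K : Set (EuclideanSpace ℝ (Fin d))) (γ : EuclideanSpace ℝ (Fin d)) :
    C(K, ℝ) :=
  ⟨fun x => Real.exp (inner ℝ γ (x : EuclideanSpace ℝ (Fin d))), by fun_prop⟩

/-- Products of exponential ridges are exponential ridges, so their span is already an algebra; the
direction `x - y` separates `x` from `y`. -/
theorem closure_span_expRidge [CompactSpace K] :
    (Submodule.span ℝ (Set.range (expRidge K))).topologicalClosure = ⊤ := by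
  let S : Submonoid C(K, ℝ) :=
    { carrier := Set.range (expRidge K)
      mul_mem' := by
        rintro _ _ ⟨γ, rfl⟩ ⟨γ', rfl⟩
        refine ⟨γ + γ', ?_⟩
        ext x
        simp [expRidge, inner_add_left, Real.exp_add]
      one_mem' := ⟨0, by ext x; simp [expRidge]⟩ }
  have hspan : Subalgebra.toSubmodule (Algebra.adjoin ℝ (S : Set C(K, ℝ)))
      = Submodule.span ℝ (Set.range (expRidge K)) := by
    rw [Algebra.adjoin_eq_span, Submonoid.closure_eq]
    rfl
  have hsep : (Algebra.adjoin ℝ (S : Set C(K, ℝ))).SeparatesPoints := by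
    intro x y hxy
    refine ⟨_, ⟨expRidge K (x - y : EuclideanSpace ℝ (Fin d)),
      Algebra.subset_adjoin ⟨_, rfl⟩, rfl⟩, ?_⟩
    intro heq
    have h1 := Real.exp_injective heq
    have h2 : inner ℝ ((x : EuclideanSpace ℝ (Fin d)) - y)
        ((x : EuclideanSpace ℝ (Fin d)) - y) = (0 : ℝ) := by
      rw [inner_sub_right]; exact sub_eq_zero.2 h1
    exact hxy (Subtype.ext (sub_eq_zero.1 (inner_self_eq_zero.1 h2)))
  have htop := ContinuousMap.subalgebra_topologicalClosure_eq_top_of_separatesPoints _ hsep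
  rw [← hspan, Submodule.eq_top_iff']
  intro f
  have : f ∈ (Algebra.adjoin ℝ (S : Set C(K, ℝ))).topologicalClosure := by rw [htop]; trivial
  exact this

/-- `exp` is monotone and continuous, so the one-dimensional approximation applies along `γ`, its
scale `k` being absorbed into the direction. -/
theorem expRidge_mem_closure_networkSpan [CompactSpace K] {σ : ℝ → ℝ} {rb : ℝ} {L : ℝ≥0}
    (hσ : IsActivation σ rb L) (γ : EuclideanSpace ℝ (Fin d)) :
    expRidge K γ ∈ (networkSpan K hσ.lipschitz.continuous).topologicalClosure := by
  let ridge : C(K, ℝ) := ⟨fun x => inner ℝ γ (x : EuclideanSpace ℝ (Fin d)), by fun_prop⟩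
  -- The extra `1` keeps the interval nondegenerate when the ridge vanishes on `K`.
  have hbd : ∀ x : K, inner ℝ γ (x : EuclideanSpace ℝ (Fin d))
      ∈ Set.Icc (-(‖ridge‖ + 1)) (‖ridge‖ + 1) := fun x => by
    have : ‖(inner ℝ γ (x : EuclideanSpace ℝ (Fin d)) : ℝ)‖ ≤ ‖ridge‖ := ridge.norm_coe_le_norm x
    rw [Real.norm_eq_abs, abs_le] at this
    exact ⟨by linarith [this.1], by linarith [this.2]⟩
  rw [← SetLike.mem_coe, Submodule.topologicalClosure_coe, Metric.mem_closure_iff]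
  intro η hη
  obtain ⟨N, k, c₀, c, t, hN⟩ := exists_sum_activation_near hσ Real.exp_monotone
    Real.continuous_exp (a := -(‖ridge‖ + 1)) (b := ‖ridge‖ + 1)
    (by linarith [norm_nonneg ridge]) (half_pos hη)
  refine ⟨c₀ • 1 + ∑ j ∈ Finset.range N, c j • unitMap K hσ.lipschitz.continuous (k • γ, t j),
    ?_, ?_⟩
  · refine Submodule.add_mem _ (Submodule.smul_mem _ _ (Submodule.subset_span (Or.inl rfl)))
      (Submodule.sum_mem _ fun j _ => Submodule.smul_mem _ _
        (Submodule.subset_span (Or.inr ⟨_, rfl⟩)))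
  · refine lt_of_le_of_lt ((ContinuousMap.dist_le (half_pos hη).le).2 fun x => ?_)
      (half_lt_self hη)
    have := hN _ (hbd x)
    simpa [Real.dist_eq, expRidge, unitMap, inner_smul_left, ContinuousMap.sum_apply] using this

theorem closure_networkSpan [CompactSpace K] {σ : ℝ → ℝ} {rb : ℝ} {L : ℝ≥0}
    (hσ : IsActivation σ rb L) :
    (networkSpan K hσ.lipschitz.continuous).topologicalClosure = ⊤ := by
  rw [eq_top_iff, ← closure_span_expRidge]
  refine Submodule.topologicalClosure_minimal _ (Submodule.span_le.2 ?_)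
    (Submodule.isClosed_topologicalClosure _)
  rintro _ ⟨γ, rfl⟩
  exact expRidge_mem_closure_networkSpan hσ γ

theorem exists_sieve_of_mem_networkSpan {σ : ℝ → ℝ} (hσ : Continuous σ) {g : C(K, ℝ)}
    (hg : g ∈ networkSpan K hσ) :
    ∃ (r₀ : ℕ) (V₀ M₀ : ℝ), ∀ (r : ℕ) (V M : ℝ), r₀ ≤ r → V₀ ≤ V → M₀ ≤ M →
      ∃ f ∈ sieve σ d r V M, ∀ x : K, f x = g x := by
  obtain ⟨α₀, z, hz, rfl⟩ := Submodule.mem_span_insert.1 hg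
  obtain ⟨c, rfl⟩ := Finsupp.mem_span_range_iff_exists_finsupp.1 hz
  -- Enumerates the units in use and pads with zero units of zero weight, so one network fits every
  -- larger width.
  let q : ℕ → EuclideanSpace ℝ (Fin d) × ℝ := fun j =>
    if hj : j < c.support.card then (c.support.equivFin.symm ⟨j, hj⟩ : _) else 0
  let α : ℕ → ℝ := fun j => if j < c.support.card then c (q j) else 0
  have hsum : ∀ F : EuclideanSpace ℝ (Fin d) × ℝ → ℝ, ∀ r, c.support.card ≤ r →
      ∑ j : Fin r, α j * F (q j) = ∑ p ∈ c.support, c p * F p := fun F r hr => by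
    rw [Fin.sum_univ_eq_sum_range (fun j => α j * F (q j)),
      ← Finset.sum_subset (Finset.range_subset_range.2 hr) (fun j _ hj => by
        simp only [α]
        rw [if_neg (by simpa using hj), zero_mul]),
      ← Fin.sum_univ_eq_sum_range (fun j => α j * F (q j)),
      ← Finset.sum_coe_sort c.support (fun p => c p * F p),
      ← Equiv.sum_comp c.support.equivFin.symm]
    refine Finset.sum_congr rfl fun j _ => ?_
    simp [α, q]
  refine ⟨c.support.card, |α₀| + ∑ j ∈ Finset.range c.support.card, |α j|,
    ∑ j ∈ Finset.range c.support.card, (|(q j).2| + ∑ i, |(q j).1 i|), fun r V M hr hV hM => ?_⟩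
  refine ⟨_, ⟨α₀, fun j => α j, fun j => (q j).2, fun j => (q j).1, ?_, ?_, rfl⟩, fun x => ?_⟩
  · rw [Fin.sum_univ_eq_sum_range (fun j => |α j|),
      ← Finset.sum_subset (Finset.range_subset_range.2 hr) (fun j _ hj => by
        simp only [α]
        rw [if_neg (by simpa using hj), abs_zero])]
    exact hV
  · intro j
    refine le_trans ?_ hM
    have hnn : ∀ i ∈ Finset.range c.support.card, 0 ≤ |(q i).2| + ∑ l, |(q i).1 l| :=
      fun i _ => by positivity
    by_cases hj : (j : ℕ) < c.support.card
    · exact Finset.single_le_sum hnn (Finset.mem_range.2 hj)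
    · have : q j = 0 := by simp only [q]; rw [dif_neg hj]
      simpa [this] using Finset.sum_nonneg hnn
  · have := hsum (fun p => σ (inner ℝ p.1 (x : EuclideanSpace ℝ (Fin d)) + p.2)) r hr
    simp only [this]
    simp [Finsupp.sum, unitMap, ContinuousMap.sum_apply]

/-- **Universal approximation**: every continuous function on a compact set is uniformly
approximated by the elements of a sufficiently large sieve. -/
theorem exists_sieve_near {σ : ℝ → ℝ} {rb : ℝ} {L : ℝ≥0} (hσ : IsActivation σ rb L)
    (hK : IsCompact K) {f₀ : EuclideanSpace ℝ (Fin d) → ℝ} (hf₀ : ContinuousOn f₀ K) {η : ℝ}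
    (hη : 0 < η) :
    ∃ (r₀ : ℕ) (V₀ M₀ : ℝ), ∀ (r : ℕ) (V M : ℝ), r₀ ≤ r → V₀ ≤ V → M₀ ≤ M →
      ∃ f ∈ sieve σ d r V M, ∀ x ∈ K, |f x - f₀ x| ≤ η := by
  have : CompactSpace K := isCompact_iff_compactSpace.1 hK
  let F : C(K, ℝ) := ⟨fun x => f₀ x, continuousOn_iff_continuous_domRestrict.1 hf₀⟩
  have hF : F ∈ closure (networkSpan K hσ.lipschitz.continuous : Set C(K, ℝ)) := by
    rw [← Submodule.topologicalClosure_coe, closure_networkSpan hσ]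
    trivial
  obtain ⟨g, hg, hdist⟩ := Metric.mem_closure_iff.1 hF η hη
  obtain ⟨r₀, V₀, M₀, h⟩ := exists_sieve_of_mem_networkSpan _ hg
  refine ⟨r₀, V₀, M₀, fun r V M hr hV hM => ?_⟩
  obtain ⟨f, hf, hfg⟩ := h r V M hr hV hM
  refine ⟨f, hf, fun x hx => ?_⟩
  have := (ContinuousMap.dist_apply_le_dist (f := F) (g := g) ⟨x, hx⟩).trans hdist.le
  rw [hfg ⟨x, hx⟩, abs_sub_comm]
  exact this

end UniversalApproximation

end NNGLS

namespace NNGLS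

/-! ### The basic inequality and its deterministic consequence -/

section BasicInequality

variable {d n : ℕ} {x : Fin n → EuclideanSpace ℝ (Fin d)}

/-- The basic inequality for a minimizer of the generalized least squares loss. -/
theorem glsLoss_basic_inequality (hn : 0 < n) {Q : Matrix (Fin n) (Fin n) ℝ} (hQ : Q.IsSymm)
    {f₀ f g : EuclideanSpace ℝ (Fin d) → ℝ} {y e : Fin n → ℝ} (hy : ∀ i, y i = f₀ (x i) + e i)
    (hle : glsLoss Q x y f ≤ glsLoss Q x y g) :
    (fun i => f₀ (x i) - f (x i)) ⬝ᵥ (Q *ᵥ fun i => f₀ (x i) - f (x i)) ≤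
      (fun i => f₀ (x i) - g (x i)) ⬝ᵥ (Q *ᵥ fun i => f₀ (x i) - g (x i)) +
        2 * (∑ i, (Q *ᵥ e) i * f (x i) - ∑ i, (Q *ᵥ e) i * g (x i)) := by
  have hexp : ∀ a : Fin n → ℝ,
      (e + a) ⬝ᵥ (Q *ᵥ (e + a)) = e ⬝ᵥ (Q *ᵥ e) + 2 * ((Q *ᵥ e) ⬝ᵥ a) + a ⬝ᵥ (Q *ᵥ a) :=
      fun a => by
    have h1 : e ⬝ᵥ (Q *ᵥ a) = (Q *ᵥ e) ⬝ᵥ a := by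
      rw [Matrix.dotProduct_mulVec, ← Matrix.mulVec_transpose, hQ.eq]
    rw [Matrix.mulVec_add, dotProduct_add, add_dotProduct, add_dotProduct, h1,
      dotProduct_comm a (Q *ᵥ e)]
    ring
  have hres : ∀ h : EuclideanSpace ℝ (Fin d) → ℝ,
      (fun i => y i - h (x i)) = e + fun i => f₀ (x i) - h (x i) := fun h => by
    ext i
    rw [hy, Pi.add_apply]
    ring
  have hlin : ∀ h : EuclideanSpace ℝ (Fin d) → ℝ,
      (Q *ᵥ e) ⬝ᵥ (fun i => f₀ (x i) - h (x i))
        = (Q *ᵥ e) ⬝ᵥ (fun i => f₀ (x i)) - ∑ i, (Q *ᵥ e) i * h (x i) := fun h =>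
    dotProduct_sub (Q *ᵥ e) (fun i => f₀ (x i)) fun i => h (x i)
  have hn' : (0 : ℝ) < 1 / n := by positivity
  have := le_of_mul_le_mul_left hle hn'
  rw [hres, hres, hexp, hexp, hlin, hlin] at this
  linarith

/-- The empirical norm of the error of a minimizer is small if the approximation error of the sieve
and the half-space sums of `Q ε` are. -/
theorem empNorm_lt_of_forall_abs_sum_lt (hn : 0 < n) {Q : Matrix (Fin n) (Fin n) ℝ}
    (hQ : Q.IsSymm) {σ : ℝ → ℝ} {rb : ℝ} {L : ℝ≥0} (hσ : IsActivation σ rb L) {r : ℕ} {V M : ℝ}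
    (hV : 0 < V) {c₁ c₂ δ η κ : ℝ} (hc₁ : 0 < c₁) (hc₂ : 0 ≤ c₂) (hδ : 0 < δ)
    (hsmall : c₂ * η ^ 2 + 4 * ((1 + 3 * rb) * κ) < c₁ * δ ^ 2)
    (hlow : ∀ v, c₁ * (v ⬝ᵥ v) ≤ v ⬝ᵥ (Q *ᵥ v)) (hhigh : ∀ v, v ⬝ᵥ (Q *ᵥ v) ≤ c₂ * (v ⬝ᵥ v))
    {f₀ f g : EuclideanSpace ℝ (Fin d) → ℝ} {y e : Fin n → ℝ} (hy : ∀ i, y i = f₀ (x i) + e i)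
    (hf : f ∈ sieve σ d r V M) (hmin : IsMinOn (glsLoss Q x y) (sieve σ d r V M) f)
    (hg : g ∈ sieve σ d r V M) (hgf₀ : ∀ i, |g (x i) - f₀ (x i)| ≤ η)
    (hW : ∀ S ∈ halfSpaceTraces x, |∑ i ∈ S, (Q *ᵥ e) i| < κ * n / V) :
    empNorm x (f - f₀) < δ := by
  have hn0 : (0 : ℝ) < n := by exact_mod_cast hn
  have hbasic := glsLoss_basic_inequality (f₀ := f₀) hn hQ hy (isMinOn_iff.1 hmin g hg)
  have hW' := fun S hS => (hW S hS).le
  have hcancel : V * ((1 + 3 * rb) * (κ * n / V)) = (1 + 3 * rb) * κ * n := by field_simp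
  have h1 := abs_sum_mul_sieve_le hσ x (Q *ᵥ e) hW' hf
  have h2 := abs_sum_mul_sieve_le hσ x (Q *ᵥ e) hW' hg
  rw [hcancel, abs_le] at h1 h2
  have h3 := hlow fun i => f₀ (x i) - f (x i)
  have h4 := hhigh fun i => f₀ (x i) - g (x i)
  have h5 : (fun i => f₀ (x i) - g (x i)) ⬝ᵥ (fun i => f₀ (x i) - g (x i)) ≤ n * η ^ 2 := by
    calc _ ≤ ∑ _i : Fin n, η ^ 2 := Finset.sum_le_sum fun i _ => by
          rw [← sq, ← sq_abs, abs_sub_comm]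
          exact pow_le_pow_left₀ (abs_nonneg _) (hgf₀ i) 2
      _ = _ := by simp
  have h6 := mul_le_mul_of_nonneg_left h5 hc₂
  have h7 : (fun i => f₀ (x i) - f (x i)) ⬝ᵥ (fun i => f₀ (x i) - f (x i))
      = ∑ i, (f - f₀) (x i) ^ 2 := Finset.sum_congr rfl fun i _ => by
    simp only [Pi.sub_apply]; ring
  rw [h7] at h3
  rw [empNorm, Real.sqrt_lt' hδ, one_div, inv_mul_lt_iff₀ hn0]
  -- The factor `4` is the `2` of the basic inequality times the two pairings, with `f` and with
  -- `g`.
  have h8 : (c₂ * η ^ 2 + 4 * ((1 + 3 * rb) * κ)) * n < c₁ * δ ^ 2 * n :=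
    mul_lt_mul_of_pos_right hsmall hn0
  refine lt_of_mul_lt_mul_left ?_ hc₁.le
  linarith [h1.1, h1.2, h2.1, h2.2]

end BasicInequality

end NNGLS

/-! ### Assembly: choice of constants and convergence in probability -/

theorem theorem2
    {Ω : Type*} [MeasurableSpace Ω] (P : Measure Ω) [IsProbabilityMeasure P]
    {d : ℕ}
    -- data generation: `Y = f₀(X) + ε` with fixed design points in a compact set,
    -- sample `n` being the `n`-th row of the arrays
    (K : Set (EuclideanSpace ℝ (Fin d))) (hK : IsCompact K)
    (f₀ : EuclideanSpace ℝ (Fin d) → ℝ) (hf₀ : ContinuousOn f₀ K)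
    (X : (n : ℕ) → Fin n → EuclideanSpace ℝ (Fin d)) (hX : ∀ n i, X n i ∈ K)
    (ε : (n : ℕ) → Fin n → Ω → ℝ)
    (hε_gauss : ∀ n, IsGaussianProcess (ε n) P)
    (hε_mean : ∀ n i, ∫ ω, ε n i ω ∂P = 0)
    (Y : (n : ℕ) → Fin n → Ω → ℝ) (hY : ∀ n i ω, Y n i ω = f₀ (X n i) + ε n i ω)
    (Ψlow Ψhigh : ℝ) (hΨlow : 0 < Ψlow)
    (hcov : ∀ n, spectrum ℝ (NNGLS.covMat P (Y n)) ⊆ Set.Icc Ψlow Ψhigh)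
    -- function class
    (σ : ℝ → ℝ) (rb : ℝ) (L : ℝ≥0) (hσ : NNGLS.IsActivation σ rb L)
    (r : ℕ → ℕ) (V M : ℕ → ℝ)
    (hV : ∀ n, 1 / (L : ℝ) < V n) (hM : ∀ n, 0 < M n)
    (hr_top : Tendsto r atTop atTop) (hV_top : Tendsto V atTop atTop)
    (hM_top : Tendsto M atTop atTop)
    (hscale : (fun n => (r n : ℝ) * V n ^ 2 * Real.log (V n * r n)) =o[atTop]
      fun n : ℕ => (n : ℝ))
    -- working precision matrix `Q`, root `R = Σ^(1/2)` of the covariance matrix,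
    -- and discrepancy matrix `Rᵀ Q R`
    (Q R : (n : ℕ) → Matrix (Fin n) (Fin n) ℝ)
    (hQ : ∀ n, (Q n).IsSymm) (hR : ∀ n, R n * (R n)ᵀ = NNGLS.covMat P (Y n))
    (Λlow Λhigh : ℝ) (hΛlow : 0 < Λlow) (hΛlow_one : Λlow ≤ 1) (hΛhigh_one : 1 ≤ Λhigh)
    (hE : ∀ n, spectrum ℝ ((R n)ᵀ * Q n * R n) ⊆ Set.Ioo Λlow Λhigh)
    -- the estimator: any minimizer of the loss over the sieve
    (fhat : (n : ℕ) → Ω → EuclideanSpace ℝ (Fin d) → ℝ)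
    (hfhat_mem : ∀ n ω, fhat n ω ∈ NNGLS.sieve σ d (r n) (V n) (M n))
    (hfhat_min : ∀ n ω, IsMinOn (NNGLS.glsLoss (Q n) (X n) fun i => Y n i ω)
      (NNGLS.sieve σ d (r n) (V n) (M n)) (fhat n ω)) :
    TendstoInMeasure P (fun n ω => NNGLS.empNorm (X n) (fhat n ω - f₀)) atTop (fun _ => 0) := by

  have hVpos : ∀ n, 0 < V n := fun n => lt_of_le_of_lt (by positivity) (hV n)
  have hrb : 0 ≤ rb := by linarith [(hσ.bounded 0).1.trans (hσ.bounded 0).2]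
  have hΛhigh : 0 < Λhigh := zero_lt_one.trans_le hΛhigh_one
  -- The maximum guarantees a positive upper bound, even for the empty spectrum at `n = 0`.
  set b := max Ψhigh Ψlow with hb
  have hbpos : 0 < b := lt_max_of_lt_right hΨlow
  have hbounds := fun n => NNGLS.quadraticForm_bounds (b := b) (hQ n) hΨlow hΛlow hΛhigh
    (by rw [hR]; exact (hcov n).trans (Set.Icc_subset_Icc_right (le_max_left _ _))) (hE n) hbpos
  have hcovε : ∀ n, NNGLS.covMat P (Y n) = NNGLS.covMat P (ε n) := fun n =>
    NNGLS.covMat_add_const (hε_gauss n) (hY n)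
  rw [tendstoInMeasure_iff_norm]
  intro δ hδ
  set c₁ := Λlow / b with hc₁
  set c₂ := Λhigh / Ψlow with hc₂
  set C := Λhigh ^ 2 / Ψlow with hC
  have hc₁pos : 0 < c₁ := by positivity
  have hc₂pos : 0 < c₂ := by positivity
  have hCpos : 0 < C := by positivity
  -- `η` and `κ` are tuned so that approximation and noise each use a quarter of `c₁ * δ ^ 2`.
  set η := Real.sqrt (c₁ * δ ^ 2 / (4 * c₂)) with hη
  have hηpos : 0 < η := Real.sqrt_pos.2 (by positivity)
  set κ := c₁ * δ ^ 2 / (16 * (1 + 3 * rb)) with hκ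
  have hκpos : 0 < κ := by positivity
  have hsmall : c₂ * η ^ 2 + 4 * ((1 + 3 * rb) * κ) < c₁ * δ ^ 2 := by
    have h1 : c₂ * η ^ 2 = c₁ * δ ^ 2 / 4 := by
      rw [hη, Real.sq_sqrt (by positivity)]
      field_simp
    have h2 : (1 + 3 * rb) * κ = c₁ * δ ^ 2 / 16 := by
      rw [hκ]
      field_simp
    have h3 : 0 < c₁ * δ ^ 2 := by positivity
    rw [h1, h2]
    linarith
  obtain ⟨r₀, V₀, M₀, happrox⟩ := NNGLS.exists_sieve_near hσ hK hf₀ hηpos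
  have htail := NNGLS.tendsto_pow_mul_exp_neg hVpos
    (fun ρ hρ => NNGLS.eventually_sq_mul_log_le hr_top hV_top hscale hρ) hκpos hCpos
    ((d : ℝ) + 2) (by positivity) (d + 1)
  have htail' := ENNReal.tendsto_ofReal htail
  rw [ENNReal.ofReal_zero] at htail'
  refine tendsto_of_tendsto_of_tendsto_of_le_of_le' tendsto_const_nhds htail'
    (Eventually.of_forall fun _ => zero_le) ?_
  filter_upwards [hr_top.eventually_ge_atTop r₀, hV_top.eventually_ge_atTop V₀,
    hM_top.eventually_ge_atTop M₀, eventually_gt_atTop 0] with n hrn hVn hMn hn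
  obtain ⟨g, hg, hgf₀⟩ := happrox (r n) (V n) (M n) hrn hVn hMn
  have hW0 : 0 ≤ κ * n / V n := by have := hVpos n; positivity
  calc P {ω | δ ≤ ‖NNGLS.empNorm (X n) (fhat n ω - f₀) - 0‖}
      ≤ P {ω | ∃ S ∈ NNGLS.halfSpaceTraces (X n),
          κ * n / V n ≤ |∑ i ∈ S, (Q n *ᵥ fun j => ε n j ω) i|} := by
        -- Monotonicity of `P` holds for arbitrary sets, so the minimizer need not be measurable.
        refine measure_mono fun ω hω => ?_
        by_contra hcon
        simp only [Set.mem_ofPred_eq, not_exists, not_and, not_le] at hcon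
        have hlt := NNGLS.empNorm_lt_of_forall_abs_sum_lt hn (hQ n) hσ (hVpos n) hc₁pos hc₂pos.le
          hδ hsmall (fun v => (hbounds n v).1) (fun v => (hbounds n v).2.1)
          (fun i => hY n i ω) (hfhat_mem n ω) (hfhat_min n ω) hg (fun i => hgf₀ _ (hX n i)) hcon
        rw [Set.mem_ofPred_eq, sub_zero,
          Real.norm_of_nonneg (show 0 ≤ NNGLS.empNorm _ _ from Real.sqrt_nonneg _)] at hω
        exact absurd hω (not_le.2 hlt)
    _ ≤ ENNReal.ofReal ((NNGLS.halfSpaceTraces (X n)).card *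
          (2 * Real.exp (-(κ * n / V n) ^ 2 / (2 * (C * n))))) :=
        NNGLS.measure_exists_abs_sum_ge_le (hε_gauss n) (hε_mean n) (hQ n) hCpos.le
          (fun v => by rw [← hcovε, ← hR]; exact (hbounds n v).2.2) _ hW0
    _ ≤ _ := by
        refine ENNReal.ofReal_le_ofReal ?_
        have hcard : ((NNGLS.halfSpaceTraces (X n)).card : ℝ)
            ≤ ((d : ℝ) + 2) * ((n : ℝ) + 1) ^ (d + 1) := by
          have := NNGLS.card_halfSpaceTraces_le (X n)
          rw [Fintype.card_fin] at this
          exact_mod_cast this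
        gcongr
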